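/- A turnstile stream over $\mathbb{Z}^d$ is a finite sequence of updates $(i,v)\in[d]\times\mathbb{Z}$; the maintained vector $x$ starts at $0$, and an update $(i,v)$ replaces $x_i$ by $x_i+v$. For $N\in\mathbb{N}$ call a stream $N$-bounded if it has at most $N$ updates, every update satisfies $|v|\le N$, and at all times all entries of $x$ are at most $N$ in absolute value. A randomized turnstile streaming algorithm with $S$ bits of space keeps a memory in $\{0,1\}^S$, which each update changes to a new memory determined by the update, the old memory, the number of earlier updates and a random seed; the estimate reported at the end is determined by the final memory, the length of the stream and the seed. The seed may be drawn from any probability space; access to it and to the number of updates read so far is not charged to the space, and computation is unrestricted. **Theorem.** There are absolute constants $\delta\in(0,1)$ and $c>0$ such that the following holds for all integers $C\ge1$ and $d\ge0$ and all real $\varepsilon>0$ with $\varepsilon\ge 6\left(\frac{\log d}{d}\right)^{1/4}$ (for $d=0$ the right-hand side, and $\log d$ below, are read as $0$). Suppose that a randomized turnstile streaming algorithm with $S$ bits of space, on every $d^C$-bounded stream over $\mathbb{Z}^d$, with probability at least $1-\delta$ outputs a number $E$ with $|E-\|x\|_\infty|\le\varepsilon\|x\|_2$, where $x$ is the vector at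 the end of the stream. Then $$S\;\ge\;c\,\varepsilon^{-2}\,\log(1/\varepsilon)\,\log d .$$ (Here $\log$ is the natural logarithm; for $\varepsilon\ge1$ the bound is trivial.) -/

import Mathlib

/-- An update `(i, v)` of a turnstile stream over coordinates `Fin d`: add `v` to coordinate `i`. -/
abbrev TurnstileUpdate (d : ℕ) : Type := Fin d × ℤ

/-- The vector `x ∈ ℤ^d` produced by a stream, starting from `x = 0`. -/
def streamVector {d : ℕ} (σ : List (TurnstileUpdate d)) (i : Fin d) : ℤ :=
  (σ.map fun u => if u.1 = i then u.2 else 0).sum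

/-- Streams with at most `N` updates, each update of size at most `N`, along which the entries of
the maintained vector stay integers of absolute value at most `N`. -/
def AdmissibleStream {d : ℕ} (N : ℕ) (σ : List (TurnstileUpdate d)) : Prop :=
  σ.length ≤ N ∧ (∀ u ∈ σ, |u.2| ≤ (N : ℤ)) ∧
    ∀ τ : List (TurnstileUpdate d), τ <+: σ → ∀ i, |streamVector τ i| ≤ (N : ℤ)

/-- `‖x‖_∞` of an integer vector (the norm of `Fin d → ℝ` is the maximum norm). -/
noncomputable def linftyNorm {d : ℕ} (x : Fin d → ℤ) : ℝ :=
  ‖(fun i => (x i : ℝ) : Fin d → ℝ)‖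

/-- `‖x‖₂` of an integer vector. -/
noncomputable def l2Norm {d : ℕ} (x : Fin d → ℤ) : ℝ :=
  ‖(WithLp.toLp 2 (fun i => (x i : ℝ)) : EuclideanSpace ℝ (Fin d))‖

/-- A memory of `S` bits. -/
abbrev BitMemory (S : ℕ) : Type := Fin S → Bool

/-- A randomized one-pass turnstile streaming algorithm for `d`-dimensional vectors that keeps `S`
bits of memory between updates.  The random seed `ω ∈ Ω` and the number of updates read so far may
be consulted for free at any time and are not charged to the memory, and there is no restriction on
the computation done in a step.  Algorithms with a random oracle as well as algorithms that flip
fresh coins in every step (disjoint parts of `ω`) are of this form. -/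
structure TurnstileAlgorithm (d S : ℕ) (Ω : Type*) [MeasurableSpace Ω] where
  /-- initial memory -/
  init : Ω → BitMemory S
  /-- new memory, from the seed, the number of earlier updates, the old memory and the update -/
  update : Ω → ℕ → BitMemory S → TurnstileUpdate d → BitMemory S
  /-- the estimate, from the seed, the number of updates in the stream and the final memory -/
  output : Ω → ℕ → BitMemory S → ℝ
  measurable_init : Measurable init
  measurable_update : ∀ n s u, Measurable fun ω => update ω n s u
  measurable_output : ∀ n s, Measurable fun ω => output ω n s

namespace TurnstileAlgorithm

variable {d S : ℕ} {Ω : Type*} [MeasurableSpace Ω]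

/-- The memory after reading a stream, if before it `n` updates were read and the memory is `s`. -/
def runFrom (A : TurnstileAlgorithm d S Ω) (ω : Ω) :
    ℕ → BitMemory S → List (TurnstileUpdate d) → BitMemory S
  | _, s, [] => s
  | n, s, u :: σ => A.runFrom ω (n + 1) (A.update ω n s u) σ

/-- The estimate reported at the end of a stream. -/
def estimate (A : TurnstileAlgorithm d S Ω) (ω : Ω) (σ : List (TurnstileUpdate d)) : ℝ :=
  A.output ω σ.length (A.runFrom ω 0 (A.init ω) σ)

/-- On every admissible stream (bound `N`), with probability at least `1 - δ` over the seed, the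
reported number is within `ε ‖x‖₂` of `‖x‖_∞`, where `x` is the vector at the end of the stream. -/
def EstimatesLinfty (A : TurnstileAlgorithm d S Ω) (μ : MeasureTheory.Measure Ω)
    (N : ℕ) (ε δ : ℝ) : Prop :=
  ∀ σ : List (TurnstileUpdate d), AdmissibleStream N σ →
    1 - δ ≤ μ.real {ω | |A.estimate ω σ - linftyNorm (streamVector σ)| ≤
      ε * l2Norm (streamVector σ)}

end TurnstileAlgorithm

/-!
The lower bound comes from a one-way communication game, augmented sparse disjointness. Alice holds
functions `f i : Fin k → Fin (2 * k)` for `i < L`, with `k` of order `ε⁻²` and `L` of order `log d`.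
She feeds the graph of each `f i` to the algorithm, scaled by `4 ^ i`, and sends the memory to Bob.
Bob holds a position `j`, all `f i` with `i > j`, and a function `g`. He deletes the scales above `j`
and adds the graph of `g`, scaled by `4 ^ j`. The maximum norm is now at least `2 * 4 ^ j` if the
graphs of `f j` and `g` meet, and at most `4 / 3 * 4 ^ j` otherwise, while the Euclidean norm is of
order `4 ^ j * √k`; so the estimate tells whether the graphs meet (`threshold_graph`). The hypothesis
on `ε` makes room for the `2 * k ^ 2` coordinates, and the total size of all updates is at most `d`,
so that already the `d`-bounded streams suffice.

The game needs `S` of order `L * k * log k`. By averaging, some seed errs only on a small fraction of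
all `(f, j, g)` (`exists_card_not_mem_le`). Fix a memory state and reveal `f` from the last letter to
the first. At each position the predictions for all `g` are determined by what is already known. Two
letters for which the same predictions are nearly right must agree in at least half of the places
(`card_avoid_meet`), so the letters for which they are nearly right form a small part, about a square
root, of the alphabet (`card_nearly_right_le`). Hence each memory state can serve only few words `f`;
`sum_prod_ite_le_pow` does this count with a penalty factor `lam` for every position where the
predictions are bad, and Jensen's inequality bounds the number of bad positions
(`card_pow_mul_le_of_decoder`).

For `ε` between `1 / 100` and `1` the same count is applied to single bits, stored at the scales
`R ^ i` of one coordinate with `R` of order `1 / (1 - ε)` (`le_space_of_large_accuracy`).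
-/

/-! ### Counting words that a decoder reads off letter by letter -/

open Classical in
/-- Reveal the letters of a word from the last one to the first. If at every position, whatever the
later letters are, at most `B` letters are good, then weighting each bad position by `lam` gives
total weight at most `(B + lam |F|) ^ L`. -/
theorem sum_prod_ite_le_pow {F : Type*} [Fintype F] {B lam : ℝ} (hlam : 0 ≤ lam) (hB : 0 ≤ B) :
    ∀ (L : ℕ) (P : Fin L → (Fin L → F) → Prop),
      (∀ j f f', (∀ i, j ≤ i → f i = f' i) → (P j f ↔ P j f')) →
      (∀ j f, (Finset.card {v | P j (Function.update f j v)} : ℝ) ≤ B) →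
      ∑ f : Fin L → F, ∏ j, (if P j f then 1 else lam) ≤ (B + lam * Fintype.card F) ^ L := by
  intro L
  induction L with
  | zero => intro P _ _; simp
  | succ L ih =>
    intro P hdep hcard
    obtain ⟨Q, hQ⟩ : ∃ Q : Fin L → (Fin L → F) → Prop,
        ∀ j f, Q j f ↔ ∃ v, P j.succ (Fin.cons v f) := ⟨_, fun _ _ => Iff.rfl⟩
    have hPQ : ∀ j v f, P j.succ (Fin.cons v f) ↔ Q j f := by
      intro j v f
      rw [hQ]
      refine ⟨fun h => ⟨v, h⟩, fun ⟨w, h⟩ => (hdep _ _ _ ?_).1 h⟩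
      intro i hi
      obtain ⟨i, rfl⟩ := Fin.exists_succ_eq.2 (show i ≠ 0 by rintro rfl; simp at hi)
      simp
    have ihQ := ih Q (by
        rintro j f f' hff
        rw [hQ, hQ]
        constructor
        · rintro ⟨v, h⟩
          refine ⟨v, (hdep _ _ _ ?_).1 h⟩
          intro i hi
          obtain ⟨i, rfl⟩ := Fin.exists_succ_eq.2 (show i ≠ 0 by rintro rfl; simp at hi)
          simpa using hff i (by simpa using hi)
        · rintro ⟨v, h⟩
          refine ⟨v, (hdep _ _ _ ?_).2 h⟩
          intro i hi
          obtain ⟨i, rfl⟩ := Fin.exists_succ_eq.2 (show i ≠ 0 by rintro rfl; simp at hi)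
          simpa using hff i (by simpa using hi)) (by
        intro j f
        by_cases hF : Nonempty F
        · obtain ⟨w⟩ := hF
          refine le_trans (le_of_eq ?_) (hcard j.succ (Fin.cons w f))
          congr 2
          ext v
          simp only [Finset.mem_filter, Finset.mem_univ, true_and]
          rw [← Fin.cons_update, hPQ]
        · have : IsEmpty F := not_nonempty_iff.1 hF
          simpa using hB)
    rw [← (Fin.consEquiv (fun _ : Fin (L + 1) => F)).sum_comp, Fintype.sum_prod_type_right, pow_succ]
    have hinner : ∀ f : Fin L → F,
        ∑ v : F, ∏ j, (if P j (Fin.consEquiv (fun _ : Fin (L + 1) => F) (v, f)) then 1 else lam)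
          ≤ (∏ j, (if Q j f then 1 else lam)) * (B + lam * Fintype.card F) := by
      intro f
      simp only [Fin.consEquiv, Equiv.coe_fn_mk, Fin.prod_univ_succ, hPQ]
      rw [← Finset.sum_mul, mul_comm]
      refine mul_le_mul_of_nonneg_left ?_ (Finset.prod_nonneg fun j _ => by split_ifs <;> simp [hlam])
      have h1 : ∀ v : F, (if P 0 (Fin.cons v f) then 1 else lam)
          ≤ (if P 0 (Fin.cons v f) then (1 : ℝ) else 0) + lam := by
        intro v; split_ifs <;> simp [hlam]
      refine (Finset.sum_le_sum fun v _ => h1 v).trans ?_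
      rw [Finset.sum_add_distrib, Finset.sum_boole, Finset.sum_const, nsmul_eq_mul, mul_comm lam]
      simp only [Finset.card_univ]
      gcongr
      by_cases hF : Nonempty F
      · obtain ⟨w⟩ := hF
        simpa using hcard 0 (Fin.cons w f)
      · have : IsEmpty F := not_nonempty_iff.1 hF
        simpa using hB
    refine (Finset.sum_le_sum fun f _ => hinner f).trans ?_
    rw [← Finset.sum_mul]
    exact mul_le_mul_of_nonneg_right ihQ (by positivity)

/-- Jensen's inequality for `e ↦ lam ^ e`, for a bound on the mean of `e`. -/
theorem card_mul_rpow_le_sum_pow {T : Type*} [Fintype T] {lam b : ℝ} (h0 : 0 < lam) (h1 : lam ≤ 1)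
    (e : T → ℕ) (he : ∑ t, (e t : ℝ) ≤ b * Fintype.card T) :
    Fintype.card T * lam ^ b ≤ ∑ t, lam ^ e t := by
  have hlog : Real.log lam ≤ 0 := Real.log_nonpos h0.le h1
  -- the tangent line of `exp` at the bound for the mean
  have key : ∀ t, lam ^ b * (1 + Real.log lam * (e t - b)) ≤ lam ^ e t := by
    intro t
    have : lam ^ e t = lam ^ b * Real.exp (Real.log lam * (e t - b)) := by
      rw [← Real.rpow_def_of_pos h0, ← Real.rpow_add h0]; simp
    rw [this]
    gcongr
    linarith [Real.add_one_le_exp (Real.log lam * (e t - b))]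
  refine le_trans ?_ (Finset.sum_le_sum fun t _ => key t)
  rw [← Finset.mul_sum, Finset.sum_add_distrib, ← Finset.mul_sum, Finset.sum_sub_distrib]
  simp only [Finset.sum_const, Finset.card_univ, nsmul_eq_mul, mul_one]
  rw [mul_comm]
  have : 0 < lam ^ b := Real.rpow_pos_of_pos h0 b
  gcongr
  nlinarith

open Classical in
/-- Lower bound for deterministic augmented indexing. A word `f` is compressed to a message
`enc f`; from the message, the position `j`, the letters after `j` and a query `g`, the decoder
predicts `h (f j) g`. If any set of predictions is nearly right (up to a fraction `η` of the
queries) for at most `B` letters, and the decoder errs on average on a fraction `δ` of all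
triples `(f, j, g)`, then there must be many messages. -/
theorem card_pow_mul_le_of_decoder {F G Msg : Type*} [Fintype F] [Fintype G] [Nonempty G]
    [Fintype Msg] {L : ℕ} {B lam η δ : ℝ} (hlam : 0 < lam) (hlam1 : lam ≤ 1) (hη : 0 < η)
    (h : F → G → Prop) (enc : (Fin L → F) → Msg) (dec : Fin L → (Fin L → F) → Msg → G → Prop)
    (hdep : ∀ j f f' m g, (∀ i, j < i → f i = f' i) → (dec j f m g ↔ dec j f' m g))
    (hB : ∀ D : G → Prop,
      (Finset.card {v | (Finset.card {g | ¬ (D g ↔ h v g)} : ℝ) ≤ η * Fintype.card G} : ℝ) ≤ B)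
    (herr : ∑ f, ∑ j, (Finset.card {g | ¬ (dec j f (enc f) g ↔ h (f j) g)} : ℝ)
      ≤ δ * ((Fintype.card F : ℝ) ^ L * L * Fintype.card G)) :
    (Fintype.card F : ℝ) ^ L * lam ^ (δ / η * L)
      ≤ Fintype.card Msg * (B + lam * Fintype.card F) ^ L := by
  have hB0 : 0 ≤ B := le_trans (Nat.cast_nonneg _) (hB fun _ => True)
  have hG : (0 : ℝ) < Fintype.card G := by exact_mod_cast Fintype.card_pos
  set P : Msg → Fin L → (Fin L → F) → Prop := fun m j f =>
    (Finset.card {g | ¬ (dec j f m g ↔ h (f j) g)} : ℝ) ≤ η * Fintype.card G with hP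
  set e : (Fin L → F) → ℕ := fun f => Finset.card {j | ¬ P (enc f) j f} with he
  have hmean : ∑ f, (e f : ℝ) ≤ (δ / η * L) * Fintype.card (Fin L → F) := by
    have h1 : ∀ f, e f * (η * Fintype.card G)
        ≤ ∑ j, (Finset.card {g | ¬ (dec j f (enc f) g ↔ h (f j) g)} : ℝ) := by
      intro f
      rw [he, ← nsmul_eq_mul]
      refine (Finset.card_nsmul_le_sum _ _ _ fun j hj => ?_).trans
        (Finset.sum_le_sum_of_subset_of_nonneg (Finset.subset_univ _) fun _ _ _ => by positivity)
      have := (Finset.mem_filter.1 hj).2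
      rw [hP] at this
      exact (not_le.1 this).le
    have h2 := (Finset.sum_le_sum fun f (_ : f ∈ Finset.univ) => h1 f).trans herr
    rw [← Finset.sum_mul] at h2
    simp only [Fintype.card_pi, Finset.prod_const, Finset.card_univ, Fintype.card_fin, Nat.cast_pow]
    have h3 : δ * ((Fintype.card F : ℝ) ^ L * L * Fintype.card G)
        = (δ / η * L * (Fintype.card F : ℝ) ^ L) * (η * Fintype.card G) := by
      field_simp
    rw [h3] at h2
    exact le_of_mul_le_mul_right h2 (by positivity)
  have hJ := card_mul_rpow_le_sum_pow hlam hlam1 e hmean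
  simp only [Fintype.card_pi, Finset.prod_const, Finset.card_univ, Fintype.card_fin,
    Nat.cast_pow] at hJ
  refine hJ.trans ?_
  have hprod : ∀ m f, ∏ j, (if P m j f then 1 else lam) = lam ^ Finset.card {j | ¬ P m j f} := by
    intro m f
    rw [Finset.prod_ite]; simp
  calc ∑ f, lam ^ e f ≤ ∑ f, ∑ m, ∏ j, (if P m j f then 1 else lam) := by
        refine Finset.sum_le_sum fun f _ => ?_
        rw [he]
        simp only [← hprod]
        exact Finset.single_le_sum (f := fun m => ∏ j, (if P m j f then 1 else lam))
          (fun m _ => Finset.prod_nonneg fun j _ => by split_ifs <;> simp [hlam.le])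
          (Finset.mem_univ (enc f))
    _ = ∑ m, ∑ f, ∏ j, (if P m j f then 1 else lam) := Finset.sum_comm
    _ ≤ ∑ _m : Msg, (B + lam * Fintype.card F) ^ L := by
        refine Finset.sum_le_sum fun m _ => sum_prod_ite_le_pow hlam.le hB0 L (P m) ?_ ?_
        · intro j f f' hff
          simp only [hP, hdep j f f' m _ fun i hi => hff i hi.le, hff j le_rfl]
        · intro j f
          refine le_trans (le_of_eq ?_) (hB (dec j f m))
          congr 2
          ext v
          have hdec : dec j (Function.update f j v) m = dec j f m := funext fun g =>
            propext (hdep _ _ _ _ _ fun i hi => by rw [Function.update_of_ne hi.ne'])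
          simp only [hP, Finset.mem_filter, Finset.mem_univ, true_and, hdec, Function.update_self]
    _ = Fintype.card Msg * (B + lam * Fintype.card F) ^ L := by simp

open Classical in
/-- If each of finitely many events has probability at least `1 - δ`, some outcome violates at most
a fraction `δ` of them. -/
theorem exists_card_not_mem_le {Ω T : Type*} [MeasurableSpace Ω] [Fintype T]
    (μ : MeasureTheory.Measure Ω) [MeasureTheory.IsProbabilityMeasure μ] {δ : ℝ} (s : T → Set Ω)
    (hs : ∀ t, MeasurableSet (s t)) (hμ : ∀ t, 1 - δ ≤ μ.real (s t)) :
    ∃ ω, (Finset.card {t | ω ∉ s t} : ℝ) ≤ δ * Fintype.card T := by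
  have hint : ∀ t ∈ Finset.univ, MeasureTheory.Integrable ((s t)ᶜ.indicator (1 : Ω → ℝ)) μ :=
    fun t _ => (MeasureTheory.integrable_const (1 : ℝ)).indicator (hs t).compl
  obtain ⟨ω, hω⟩ := MeasureTheory.exists_le_integral
    (MeasureTheory.integrable_finsetSum Finset.univ hint)
  refine ⟨ω, ?_⟩
  rw [MeasureTheory.integral_finsetSum _ hint] at hω
  have h1 : ∑ t, (s t)ᶜ.indicator (1 : Ω → ℝ) ω = Finset.card {t | ω ∉ s t} := by
    simp only [Set.indicator_apply, Set.mem_compl_iff, Pi.one_apply, Finset.sum_boole]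
  rw [h1] at hω
  refine hω.trans ?_
  refine (Finset.sum_le_sum (g := fun _ => δ) fun t _ => ?_).trans (by simp [mul_comm])
  rw [MeasureTheory.integral_indicator_one (hs t).compl,
    MeasureTheory.probReal_compl_eq_one_sub (hs t)]
  linarith [hμ t]

/-! ### Random functions that agree nowhere -/

open Classical in
theorem card_forall_ne {k q : ℕ} (f f' : Fin k → Fin q) :
    Finset.card {g : Fin k → Fin q | ∀ r, g r ≠ f r ∧ g r ≠ f' r}
      = (q - 1) ^ (Finset.card {r | f r = f' r}) * (q - 2) ^ (Finset.card {r | f r ≠ f' r}) := by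
  have h1 : ({g : Fin k → Fin q | ∀ r, g r ≠ f r ∧ g r ≠ f' r} : Finset _)
      = Fintype.piFinset fun r => ({f r, f' r} : Finset (Fin q))ᶜ := by
    ext g; simp [Fintype.mem_piFinset]
  rw [h1, Fintype.card_piFinset]
  have h2 : ∀ r, (({f r, f' r} : Finset (Fin q))ᶜ).card = if f r = f' r then q - 1 else q - 2 := by
    intro r
    rw [Finset.card_compl, Fintype.card_fin]
    split_ifs with h
    · simp [h]
    · rw [Finset.card_pair h]
  simp only [h2, Finset.prod_ite, Finset.prod_const]

open Classical in
/-- If `f` and `f'` differ in more than half of the places, then at least a tenth of all functions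
`g` avoids `f` but meets `f'`. -/
theorem card_avoid_meet {k : ℕ} (hk : 2 ≤ k) (f f' : Fin k → Fin (2 * k))
    (hff : k < 2 * Finset.card {r | f r ≠ f' r}) :
    ((2 * k : ℝ)) ^ k / 10
      ≤ Finset.card {g : Fin k → Fin (2 * k) | (∀ r, g r ≠ f r) ∧ ¬ ∀ r, g r ≠ f' r} := by
  set a := Finset.card {r | f r = f' r} with ha
  set b := Finset.card {r | f r ≠ f' r} with hb
  have hab : a + b = k := by
    have := Finset.card_filter_add_card_filter_not (s := (Finset.univ : Finset (Fin k)))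
      (fun r => f r = f' r)
    simpa using this
  have h1 : Finset.card {g : Fin k → Fin (2 * k) | ∀ r, g r ≠ f r} = (2 * k - 1) ^ k := by
    have := card_forall_ne f f
    simpa using this
  have h2 := card_forall_ne f f'
  have h3 : Finset.card {g : Fin k → Fin (2 * k) | (∀ r, g r ≠ f r) ∧ ¬ ∀ r, g r ≠ f' r}
      + Finset.card {g : Fin k → Fin (2 * k) | ∀ r, g r ≠ f r ∧ g r ≠ f' r}
      = Finset.card {g : Fin k → Fin (2 * k) | ∀ r, g r ≠ f r} := by
    rw [add_comm, ← Finset.card_filter_add_card_filter_not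
      (s := ({g : Fin k → Fin (2 * k) | ∀ r, g r ≠ f r} : Finset _)) (fun g => ∀ r, g r ≠ f' r),
      Finset.filter_filter, Finset.filter_filter]
    simp only [forall_and]
  rw [h1, h2] at h3
  have h4 : (Finset.card {g : Fin k → Fin (2 * k) | (∀ r, g r ≠ f r) ∧ ¬ ∀ r, g r ≠ f' r} : ℝ)
      = (2 * k - 1 : ℝ) ^ k - (2 * k - 1 : ℝ) ^ a * (2 * k - 2 : ℝ) ^ b := by
    have := congrArg (Nat.cast : ℕ → ℝ) h3
    push_cast [Nat.cast_sub (show 1 ≤ 2 * k by lia), Nat.cast_sub (show 2 ≤ 2 * k by lia)] at this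
    linarith
  rw [h4]
  have hk' : (2 : ℝ) ≤ k := by exact_mod_cast hk
  have hbk : (k : ℝ) < 2 * b := by exact_mod_cast hff
  -- Bernoulli's inequality twice: `(1 - 1/(2k))^k ≥ 1/2` and `(1 + 1/(2k-2))^b ≥ 5/4`
  have b1 : (2 * k : ℝ) ^ k / 2 ≤ (2 * k - 1 : ℝ) ^ k := by
    have := one_add_mul_le_pow (a := -(1 / (2 * k : ℝ))) (by
      have : 1 / (2 * k : ℝ) ≤ 1 := by rw [div_le_one (by positivity)]; linarith
      linarith) k
    have e1 : 1 + (k : ℝ) * -(1 / (2 * k : ℝ)) = 1 / 2 := by field_simp; norm_num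
    have e2 : (2 * k - 1 : ℝ) ^ k = (2 * k : ℝ) ^ k * (1 + -(1 / (2 * k : ℝ))) ^ k := by
      rw [← mul_pow]; congr 1; field_simp; ring
    rw [e1] at this
    rw [e2, div_eq_mul_one_div]
    gcongr
  have b2 : 5 / 4 * (2 * k - 2 : ℝ) ^ b ≤ (2 * k - 1 : ℝ) ^ b := by
    have hpos : (0 : ℝ) < 2 * k - 2 := by linarith
    have := one_add_mul_le_pow (a := 1 / (2 * k - 2 : ℝ)) (by
      have : 0 < 1 / (2 * k - 2 : ℝ) := by positivity
      linarith) b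
    have e1 : (5 / 4 : ℝ) ≤ 1 + (b : ℝ) * (1 / (2 * k - 2 : ℝ)) := by
      have : (1 / 4 : ℝ) ≤ (b : ℝ) * (1 / (2 * k - 2 : ℝ)) := by
        rw [mul_one_div, le_div_iff₀ hpos]; linarith
      linarith
    have e2 : (2 * k - 1 : ℝ) ^ b = (1 + 1 / (2 * k - 2 : ℝ)) ^ b * (2 * k - 2 : ℝ) ^ b := by
      rw [← mul_pow, add_mul, one_div_mul_cancel hpos.ne']; congr 1; ring
    rw [e2]
    gcongr
    linarith
  have b3 : (2 * k - 1 : ℝ) ^ k = (2 * k - 1 : ℝ) ^ a * (2 * k - 1 : ℝ) ^ b := by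
    rw [← pow_add, hab]
  have b4 : (0 : ℝ) ≤ (2 * k - 1 : ℝ) ^ a := pow_nonneg (by linarith) _
  nlinarith [mul_le_mul_of_nonneg_left b2 b4]

open Classical in
/-- The size of a Hamming ball, bounded by giving each change of a letter the weight `1/q`. -/
theorem card_hamming_le {k q : ℕ} (hq : 0 < q) (f : Fin k → Fin q) :
    (Finset.card {f' : Fin k → Fin q | 2 * Finset.card {r | f r ≠ f' r} ≤ k} : ℝ)
      ≤ 2 ^ k * (q : ℝ) ^ ((k : ℝ) / 2) := by
  have hq' : (1 : ℝ) ≤ q := by exact_mod_cast hq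
  have hsum : ∑ f' : Fin k → Fin q, ∏ r, (if f r = f' r then (1 : ℝ) else (q : ℝ)⁻¹) ≤ 2 ^ k := by
    rw [← Fintype.piFinset_univ,
      ← Finset.prod_univ_sum (fun _ => Finset.univ) (fun r v => if f r = v then (1 : ℝ) else (q : ℝ)⁻¹)]
    refine (Finset.prod_le_prod (g := fun _ => (2 : ℝ)) (fun r _ => Finset.sum_nonneg fun v _ => by
      split_ifs <;> positivity) fun r _ => ?_).trans (by simp)
    calc ∑ v, (if f r = v then (1 : ℝ) else (q : ℝ)⁻¹)
        ≤ ∑ v, ((if f r = v then (1 : ℝ) else 0) + (q : ℝ)⁻¹) := by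
          refine Finset.sum_le_sum fun v _ => ?_
          split_ifs <;> simp
      _ = 2 := by
          rw [Finset.sum_add_distrib]
          simp
          rw [mul_inv_cancel₀ (by positivity)]
          norm_num
  have hone : ∀ f' ∈ ({f' : Fin k → Fin q | 2 * Finset.card {r | f r ≠ f' r} ≤ k} : Finset _),
      ((q : ℝ) ^ ((k : ℝ) / 2))⁻¹ ≤ ∏ r, (if f r = f' r then (1 : ℝ) else (q : ℝ)⁻¹) := by
    intro f' hf'
    have hf' := (Finset.mem_filter.1 hf').2
    rw [Finset.prod_ite, Finset.prod_const_one, one_mul, Finset.prod_const, inv_pow,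
      ← Real.rpow_natCast]
    gcongr
    rw [le_div_iff₀ two_pos, mul_comm]
    exact_mod_cast hf'
  have h2 := (Finset.card_nsmul_le_sum _ _ _ hone).trans
    ((Finset.sum_le_sum_of_subset_of_nonneg (Finset.subset_univ _) fun _ _ _ =>
      Finset.prod_nonneg fun r _ => by split_ifs <;> positivity).trans hsum)
  rw [nsmul_eq_mul, ← div_eq_mul_inv, div_le_iff₀ (by positivity)] at h2
  exact h2

open Classical in
/-- A set of predictions `D` for whether `g` meets `f` is nearly right only for the `f` in one
Hamming ball: two such `f` predict nearly the same answers, so they cannot differ in more than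
half of the places. -/
theorem card_nearly_right_le {k : ℕ} (hk : 2 ≤ k) (D : (Fin k → Fin (2 * k)) → Prop) :
    (Finset.card {f : Fin k → Fin (2 * k) |
      (Finset.card {g | ¬ (D g ↔ ∃ r, g r = f r)} : ℝ)
        ≤ 1 / 25 * Fintype.card (Fin k → Fin (2 * k))} : ℝ)
      ≤ 2 ^ k * ((2 * k : ℕ) : ℝ) ^ ((k : ℝ) / 2) := by
  set 𝓕 : Finset (Fin k → Fin (2 * k)) := {f |
      (Finset.card {g | ¬ (D g ↔ ∃ r, g r = f r)} : ℝ)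
        ≤ 1 / 25 * Fintype.card (Fin k → Fin (2 * k))} with h𝓕
  rcases 𝓕.eq_empty_or_nonempty with h | ⟨f, hf⟩
  · rw [h, Finset.card_empty, Nat.cast_zero]; positivity
  refine le_trans ?_ (card_hamming_le (show 0 < 2 * k by lia) f)
  refine Nat.cast_le.2 (Finset.card_le_card fun f' hf' => ?_)
  rw [Finset.mem_filter]
  refine ⟨Finset.mem_univ _, not_lt.1 fun hlt => ?_⟩
  have h1 := card_avoid_meet hk f f' hlt
  have hf := (Finset.mem_filter.1 hf).2
  have hf' := (Finset.mem_filter.1 hf').2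
  have h2 : Finset.card {g : Fin k → Fin (2 * k) | (∀ r, g r ≠ f r) ∧ ¬ ∀ r, g r ≠ f' r}
      ≤ Finset.card {g | ¬ (D g ↔ ∃ r, g r = f r)}
        + Finset.card {g | ¬ (D g ↔ ∃ r, g r = f' r)} := by
    refine le_trans (Finset.card_le_card fun g hg => ?_) (Finset.card_union_le _ _)
    simp only [Finset.mem_filter, Finset.mem_univ, true_and, Finset.mem_union] at hg ⊢
    have e1 : ¬ ∃ r, g r = f r := by push Not; exact hg.1
    have e2 : ∃ r, g r = f' r := by simpa using hg.2
    by_cases hD : D g <;> simp [hD, e1, e2]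
  have h2' : (_ : ℝ) ≤ _ := Nat.cast_le (α := ℝ).2 h2
  push_cast at h2'
  simp only [Fintype.card_pi, Finset.prod_const, Finset.card_univ, Fintype.card_fin,
    Nat.cast_pow] at hf hf'
  push_cast at hf hf'
  have hpos : (0 : ℝ) < (2 * k : ℝ) ^ k := by
    have : (2 : ℝ) ≤ k := by exact_mod_cast hk
    positivity
  linarith

/-! ### Streams and their vectors -/

theorem streamVector_append {d : ℕ} (σ τ : List (TurnstileUpdate d)) :
    streamVector (σ ++ τ) = streamVector σ + streamVector τ := by
  ext i; simp [streamVector]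

theorem streamVector_flatMap_finRange {d L : ℕ} (s : Fin L → List (TurnstileUpdate d)) :
    streamVector ((List.finRange L).flatMap s) = ∑ i, streamVector (s i) := by
  have h : ∀ l : List (Fin L), streamVector (l.flatMap s) = (l.map fun i => streamVector (s i)).sum := by
    intro l
    induction l with
    | nil => ext i; simp [streamVector]
    | cons a l ih => rw [List.flatMap_cons, streamVector_append, ih]; simp
  rw [h, Fin.sum_univ_def]

/-- The stream that undoes the updates of `σ`. -/
def negStream {d : ℕ} (σ : List (TurnstileUpdate d)) : List (TurnstileUpdate d) :=
  σ.map fun u => (u.1, -u.2)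

theorem streamVector_negStream {d : ℕ} (σ : List (TurnstileUpdate d)) :
    streamVector (negStream σ) = -streamVector σ := by
  ext i
  induction σ with
  | nil => simp [negStream, streamVector]
  | cons u σ ih =>
    simp only [streamVector, negStream, List.map_cons, List.sum_cons, Pi.neg_apply,
      neg_add_rev] at ih ⊢
    rw [ih]
    split_ifs <;> ring

/-- The total size of the updates of a stream, where an update counts at least `1`. It bounds
the length of the stream and all entries of its vector. -/
def streamWeight {d : ℕ} (σ : List (TurnstileUpdate d)) : ℤ :=
  (σ.map fun u => max 1 |u.2|).sum

theorem streamWeight_append {d : ℕ} (σ τ : List (TurnstileUpdate d)) :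
    streamWeight (σ ++ τ) = streamWeight σ + streamWeight τ := by
  simp [streamWeight]

theorem streamWeight_nonneg {d : ℕ} (σ : List (TurnstileUpdate d)) : 0 ≤ streamWeight σ :=
  List.sum_nonneg fun x hx => by
    obtain ⟨u, -, rfl⟩ := List.mem_map.1 hx
    exact le_max_of_le_left zero_le_one

theorem streamWeight_negStream {d : ℕ} (σ : List (TurnstileUpdate d)) :
    streamWeight (negStream σ) = streamWeight σ := by
  simp [streamWeight, negStream, Function.comp_def]

theorem streamWeight_flatMap_finRange {d L : ℕ} (s : Fin L → List (TurnstileUpdate d)) :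
    streamWeight ((List.finRange L).flatMap s) = ∑ i, streamWeight (s i) := by
  have h : ∀ l : List (Fin L), streamWeight (l.flatMap s) = (l.map fun i => streamWeight (s i)).sum := by
    intro l
    induction l with
    | nil => simp [streamWeight]
    | cons a l ih => rw [List.flatMap_cons, streamWeight_append, ih]; simp
  rw [h, Fin.sum_univ_def]

theorem admissibleStream_of_streamWeight_le {d N : ℕ} {σ : List (TurnstileUpdate d)}
    (h : streamWeight σ ≤ N) : AdmissibleStream N σ := by
  have hlen : ∀ σ : List (TurnstileUpdate d), (σ.length : ℤ) ≤ streamWeight σ := by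
    intro σ
    induction σ with
    | nil => simp [streamWeight]
    | cons u σ ih =>
      simp only [streamWeight, List.map_cons, List.sum_cons, List.length_cons] at ih ⊢
      push_cast
      linarith [le_max_left 1 |u.2|]
  have habs : ∀ (σ : List (TurnstileUpdate d)) i, |streamVector σ i| ≤ streamWeight σ := by
    intro σ i
    induction σ with
    | nil => simp [streamWeight, streamVector]
    | cons u σ ih =>
      simp only [streamWeight, streamVector, List.map_cons, List.sum_cons] at ih ⊢
      refine (abs_add_le _ _).trans (add_le_add ?_ ih)
      split_ifs <;> simp
  refine ⟨by exact_mod_cast (hlen σ).trans h, fun u hu => ?_, fun τ hτ i => ?_⟩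
  · refine le_trans ?_ h
    refine (le_max_right 1 |u.2|).trans (List.single_le_sum (fun x hx => ?_) _
      (List.mem_map_of_mem hu))
    obtain ⟨u, -, rfl⟩ := List.mem_map.1 hx
    exact le_max_of_le_left zero_le_one
  · obtain ⟨ρ, rfl⟩ := hτ
    rw [streamWeight_append] at h
    linarith [habs τ i, streamWeight_nonneg ρ]

theorem linftyNorm_add_le {d : ℕ} (x y : Fin d → ℤ) :
    linftyNorm (x + y) ≤ linftyNorm x + linftyNorm y := by
  refine le_trans (le_of_eq ?_) (norm_add_le _ _)
  rw [linftyNorm]; congr 1; ext i; simp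

theorem l2Norm_add_le {d : ℕ} (x y : Fin d → ℤ) : l2Norm (x + y) ≤ l2Norm x + l2Norm y := by
  refine le_trans (le_of_eq ?_) (norm_add_le _ _)
  rw [l2Norm]; congr 1; ext i; simp

theorem linftyNorm_smul {d : ℕ} (a : ℤ) (x : Fin d → ℤ) :
    linftyNorm (a • x) = |(a : ℝ)| * linftyNorm x := by
  rw [linftyNorm, linftyNorm, ← Real.norm_eq_abs, ← norm_smul]; congr 1; ext i; simp

theorem l2Norm_smul {d : ℕ} (a : ℤ) (x : Fin d → ℤ) :
    l2Norm (a • x) = |(a : ℝ)| * l2Norm x := by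
  rw [l2Norm, l2Norm, ← Real.norm_eq_abs, ← norm_smul]; congr 1; ext i; simp

theorem linftyNorm_sum_le {d : ℕ} {ι : Type*} (s : Finset ι) (x : ι → Fin d → ℤ) :
    linftyNorm (∑ i ∈ s, x i) ≤ ∑ i ∈ s, linftyNorm (x i) :=
  Finset.le_sum_of_subadditive linftyNorm (by simp [linftyNorm, ← Pi.zero_def]) linftyNorm_add_le s x

theorem l2Norm_sum_le {d : ℕ} {ι : Type*} (s : Finset ι) (x : ι → Fin d → ℤ) :
    l2Norm (∑ i ∈ s, x i) ≤ ∑ i ∈ s, l2Norm (x i) :=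
  Finset.le_sum_of_subadditive l2Norm (by simp [l2Norm, ← Pi.zero_def]) l2Norm_add_le s x

theorem abs_le_linftyNorm {d : ℕ} (x : Fin d → ℤ) (i : Fin d) : |(x i : ℝ)| ≤ linftyNorm x :=
  norm_le_pi_norm (fun i => (x i : ℝ)) i

theorem linftyNorm_le {d : ℕ} {x : Fin d → ℤ} {a : ℝ} (ha : 0 ≤ a) (h : ∀ i, |(x i : ℝ)| ≤ a) :
    linftyNorm x ≤ a :=
  (pi_norm_le_iff_of_nonneg ha).2 h

/-! ### Streaming algorithms and augmented indexing -/

/-- The stream of the augmented indexing game: the letters `f i` of a word are inserted by the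
streams `enc i (f i)`, then those after position `j` are deleted again, and the query `query j g`
is made. -/
def augmentedStream {d L : ℕ} {F G : Type*} (enc : Fin L → F → List (TurnstileUpdate d))
    (query : Fin L → G → List (TurnstileUpdate d)) (f : Fin L → F) (j : Fin L) (g : G) :
    List (TurnstileUpdate d) :=
  (List.finRange L).flatMap (fun i => enc i (f i)) ++
    ((List.finRange L).flatMap (fun i => if j < i then negStream (enc i (f i)) else []) ++ query j g)

theorem streamVector_augmentedStream {d L : ℕ} {F G : Type*}
    (enc : Fin L → F → List (TurnstileUpdate d)) (query : Fin L → G → List (TurnstileUpdate d))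
    (f : Fin L → F) (j : Fin L) (g : G) :
    streamVector (augmentedStream enc query f j g)
      = ∑ i ∈ Finset.Iio j, streamVector (enc i (f i))
        + (streamVector (enc j (f j)) + streamVector (query j g)) := by
  have h0 : streamVector ([] : List (TurnstileUpdate d)) = 0 := by ext; simp [streamVector]
  rw [augmentedStream, streamVector_append, streamVector_append, streamVector_flatMap_finRange,
    streamVector_flatMap_finRange, ← add_assoc, ← add_assoc, ← Finset.sum_add_distrib]
  congr 1
  have h1 : ∀ i, streamVector (enc i (f i))
      + streamVector (if j < i then negStream (enc i (f i)) else [])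
      = if i ≤ j then streamVector (enc i (f i)) else 0 := by
    intro i
    by_cases hij : j < i
    · simp [hij, streamVector_negStream]
    · simp [hij, not_lt.1 hij, h0]
  simp only [h1]
  have h2 : ({i | i ≤ j} : Finset (Fin L)) = Finset.cons j (Finset.Iio j) (by simp) := by
    ext i; simp [le_iff_eq_or_lt]
  rw [← Finset.sum_filter, h2, Finset.sum_cons, add_comm]

theorem streamWeight_augmentedStream_le {d L : ℕ} {F G : Type*}
    (enc : Fin L → F → List (TurnstileUpdate d)) (query : Fin L → G → List (TurnstileUpdate d))
    (W : Fin L → ℤ) (henc : ∀ i v, streamWeight (enc i v) ≤ W i)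
    (hquery : ∀ j g, streamWeight (query j g) ≤ W j) (f : Fin L → F) (j : Fin L) (g : G) :
    streamWeight (augmentedStream enc query f j g) ≤ 2 * ∑ i, W i := by
  have hW : ∀ i, 0 ≤ W i := fun i => (streamWeight_nonneg _).trans (henc i (f i))
  rw [augmentedStream, streamWeight_append, streamWeight_append, streamWeight_flatMap_finRange,
    streamWeight_flatMap_finRange, two_mul]
  refine add_le_add (Finset.sum_le_sum fun i _ => henc i _) ?_
  rw [← Finset.add_sum_erase Finset.univ W (Finset.mem_univ j), add_comm,
    ← Finset.add_sum_erase Finset.univ _ (Finset.mem_univ j)]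
  refine add_le_add (hquery j g) ?_
  have h0 : streamWeight ([] : List (TurnstileUpdate d)) = 0 := rfl
  simp only [lt_irrefl, if_false, h0, zero_add]
  refine Finset.sum_le_sum fun i _ => ?_
  split_ifs
  · rw [streamWeight_negStream]; exact henc i _
  · rw [h0]; exact hW i

namespace TurnstileAlgorithm

variable {d S : ℕ} {Ω : Type*} [MeasurableSpace Ω]

theorem runFrom_append (A : TurnstileAlgorithm d S Ω) (ω : Ω) (σ τ : List (TurnstileUpdate d)) :
    ∀ (n : ℕ) (s : BitMemory S),
      A.runFrom ω n s (σ ++ τ) = A.runFrom ω (n + σ.length) (A.runFrom ω n s σ) τ := by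
  induction σ with
  | nil => intro n s; rfl
  | cons u σ ih =>
    intro n s
    simp only [List.cons_append, runFrom, ih, List.length_cons]
    congr 1
    ring

theorem measurable_runFrom (A : TurnstileAlgorithm d S Ω) (σ : List (TurnstileUpdate d)) :
    ∀ (n : ℕ) (s : Ω → BitMemory S), Measurable s → Measurable fun ω => A.runFrom ω n (s ω) σ := by
  induction σ with
  | nil => intro n s hs; exact hs
  | cons u σ ih =>
    intro n s hs
    refine ih (n + 1) (fun ω => A.update ω n (s ω) u) ?_
    have h : Measurable fun p : Ω × BitMemory S => A.update p.1 n p.2 u :=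
      measurable_from_prod_countable_left fun t => A.measurable_update n t u
    exact h.comp (measurable_id.prodMk hs)

theorem measurable_estimate (A : TurnstileAlgorithm d S Ω) (σ : List (TurnstileUpdate d)) :
    Measurable fun ω => A.estimate ω σ := by
  have h : Measurable fun p : Ω × BitMemory S => A.output p.1 σ.length p.2 :=
    measurable_from_prod_countable_left fun t => A.measurable_output σ.length t
  exact h.comp (measurable_id.prodMk (A.measurable_runFrom σ 0 A.init A.measurable_init))

open Classical in
/-- An algorithm that estimates the maximum norm plays the augmented indexing game with its memory
as the message: if every correct estimate for the stream of the game lies above the threshold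
`θ j` exactly if `h (f j) g` holds, then the space is bounded below. -/
theorem log_le_of_augmented (A : TurnstileAlgorithm d S Ω)
    (μ : MeasureTheory.Measure Ω) [MeasureTheory.IsProbabilityMeasure μ] {N : ℕ} {ε δ : ℝ}
    (hA : A.EstimatesLinfty μ N ε δ) {L : ℕ} {F G : Type*} [Fintype F] [Fintype G] [Nonempty F]
    [Nonempty G] {B lam η : ℝ} (hlam : 0 < lam) (hlam1 : lam ≤ 1) (hη : 0 < η)
    (h : F → G → Prop)
    (hB : ∀ D : G → Prop,
      (Finset.card {v | (Finset.card {g | ¬ (D g ↔ h v g)} : ℝ) ≤ η * Fintype.card G} : ℝ) ≤ B)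
    (enc : Fin L → F → List (TurnstileUpdate d)) (query : Fin L → G → List (TurnstileUpdate d))
    (ℓ : ℕ) (hℓ : ∀ i v, (enc i v).length = ℓ)
    (W : Fin L → ℤ) (henc : ∀ i v, streamWeight (enc i v) ≤ W i)
    (hquery : ∀ j g, streamWeight (query j g) ≤ W j) (hW : 2 * ∑ i, W i ≤ N) (θ : Fin L → ℝ)
    (hθ : ∀ (f : Fin L → F) j g (E : ℝ),
      |E - linftyNorm (streamVector (augmentedStream enc query f j g))|
        ≤ ε * l2Norm (streamVector (augmentedStream enc query f j g)) →
      (θ j < E ↔ h (f j) g)) :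
    L * (Real.log (Fintype.card F) + δ / η * Real.log lam
      - Real.log (B + lam * Fintype.card F)) ≤ S * Real.log 2 := by
  set first : (Fin L → F) → List (TurnstileUpdate d) := fun f =>
    (List.finRange L).flatMap fun i => enc i (f i) with hfirst
  set tail : Fin L → (Fin L → F) → G → List (TurnstileUpdate d) := fun j f g =>
    (List.finRange L).flatMap (fun i => if j < i then negStream (enc i (f i)) else []) ++ query j g
    with htail
  have hlen : ∀ f, (first f).length = L * ℓ := by
    intro f
    simp [hfirst, List.length_flatMap, hℓ]
  -- one seed that errs on few games
  obtain ⟨ω, hω⟩ := exists_card_not_mem_le (T := ((Fin L → F) × Fin L) × G) μ (δ := δ)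
    (fun t => {ω | |A.estimate ω (augmentedStream enc query t.1.1 t.1.2 t.2)
        - linftyNorm (streamVector (augmentedStream enc query t.1.1 t.1.2 t.2))|
      ≤ ε * l2Norm (streamVector (augmentedStream enc query t.1.1 t.1.2 t.2))})
    (fun t => by
      have := A.measurable_estimate (augmentedStream enc query t.1.1 t.1.2 t.2)
      exact measurableSet_le (continuous_abs.measurable.comp (this.sub_const _)) measurable_const)
    (fun t => hA _ (admissibleStream_of_streamWeight_le
      ((streamWeight_augmentedStream_le enc query W henc hquery _ _ _).trans hW)))
  have key := card_pow_mul_le_of_decoder (δ := δ) hlam hlam1 hη h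
    (fun f => A.runFrom ω 0 (A.init ω) (first f))
    (fun j f m g => θ j < A.output ω (L * ℓ + (tail j f g).length)
      (A.runFrom ω (L * ℓ) m (tail j f g)))
    (by
      intro j f f' m g hff
      have : tail j f g = tail j f' g := by
        simp only [htail]
        congr 2
        ext1 i
        split_ifs with hi
        · rw [hff i hi]
        · rfl
      simp only [this]) hB
    (by
      refine le_trans ?_ (hω.trans (le_of_eq (by simp [Fintype.card_prod])))
      simp only [Finset.card_filter, Nat.cast_sum, Fintype.sum_prod_type]
      refine Finset.sum_le_sum fun f _ => Finset.sum_le_sum fun j _ =>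
        Finset.sum_le_sum fun g _ => ?_
      have hest : A.estimate ω (augmentedStream enc query f j g)
          = A.output ω (L * ℓ + (tail j f g).length)
            (A.runFrom ω (L * ℓ) (A.runFrom ω 0 (A.init ω) (first f)) (tail j f g)) := by
        have : augmentedStream enc query f j g = first f ++ tail j f g := rfl
        rw [estimate, this, runFrom_append, List.length_append, hlen, zero_add]
      rw [← hest]
      by_cases hgood : |A.estimate ω (augmentedStream enc query f j g)
          - linftyNorm (streamVector (augmentedStream enc query f j g))|
        ≤ ε * l2Norm (streamVector (augmentedStream enc query f j g))
      · simp only [hθ f j g _ hgood, not_true_eq_false, if_false]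
        split_ifs <;> simp
      · simp only [Set.mem_ofPred_eq, hgood, not_false_eq_true, if_true]
        split_ifs <;> simp)
  have hB0 : 0 ≤ B := le_trans (Nat.cast_nonneg _) (hB fun _ => True)
  have hF : (0 : ℝ) < Fintype.card F := by exact_mod_cast Fintype.card_pos
  have hpos : 0 < B + lam * Fintype.card F := by positivity
  have hcard : (Fintype.card (BitMemory S) : ℝ) = 2 ^ S := by simp [BitMemory]
  rw [hcard] at key
  have hlog := Real.log_le_log (by positivity) key
  rw [Real.log_mul (by positivity) (by positivity), Real.log_mul (by positivity) (by positivity),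
    Real.log_pow, Real.log_pow, Real.log_pow, Real.log_rpow hlam] at hlog
  linarith

end TurnstileAlgorithm

/-! ### Geometric scales -/

theorem sum_Iio_pow_le {R : ℝ} (hR : 1 < R) {L : ℕ} (j : Fin L) :
    ∑ i ∈ Finset.Iio j, R ^ (i : ℕ) ≤ R ^ (j : ℕ) / (R - 1) := by
  have h : ∑ i ∈ Finset.Iio j, R ^ (i : ℕ) = ∑ i ∈ Finset.range j, R ^ i := by
    rw [← Nat.Iio_eq_range, ← Fin.map_valEmbedding_Iio, Finset.sum_map]; rfl
  rw [h, geom_sum_eq hR.ne']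
  gcongr
  linarith

theorem two_mul_sum_pow_le {R : ℕ} (hR : 3 ≤ R) (L : ℕ) : 2 * ∑ i : Fin L, R ^ (i : ℕ) ≤ R ^ L := by
  induction L with
  | zero => simp
  | succ L ih =>
    rw [Fin.sum_univ_castSucc, pow_succ]
    simp only [Fin.val_castSucc, Fin.val_last]
    nlinarith [Nat.mul_le_mul_left (R ^ L) hR]

theorem log_le_two_mul_log_of_nat_log_le {R d L : ℕ} (hR : 2 ≤ R) (hd : 1 ≤ d) (hL : 1 ≤ L)
    (h : Nat.log R d ≤ L) : Real.log d ≤ 2 * L * Real.log R := by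
  have h1 : d ≤ R ^ (2 * L) :=
    (Nat.lt_pow_succ_log_self (by lia) d).le.trans (Nat.pow_le_pow_right (by lia) (by lia))
  have h2 : (d : ℝ) ≤ (R : ℝ) ^ (2 * L) := by exact_mod_cast h1
  have h3 := Real.log_le_log (by positivity) h2
  rw [Real.log_pow] at h3
  push_cast at h3
  exact h3

/-! ### Accuracy close to one: one coordinate, many scales -/

theorem linftyNorm_single {d : ℕ} (c : Fin d) : linftyNorm (Pi.single c 1) = 1 := by
  refine le_antisymm (linftyNorm_le zero_le_one fun i => ?_) ?_
  · by_cases h : i = c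
    · subst h; simp
    · simp [h]
  · simpa using abs_le_linftyNorm (Pi.single c 1) c

theorem l2Norm_single {d : ℕ} (c : Fin d) : l2Norm (Pi.single c 1) = 1 := by
  rw [l2Norm, EuclideanSpace.norm_eq, Real.sqrt_eq_one]
  rw [Finset.sum_eq_single c] <;> simp +contextual

theorem streamVector_singleton {d : ℕ} (c : Fin d) (w : ℤ) :
    streamVector [(c, w)] = w • Pi.single c 1 := by
  ext i
  by_cases h : i = c
  · subst h; simp [streamVector]
  · simp [streamVector, h, Ne.symm h]

open Classical in
/-- A prediction of a bit errs on at least one of the two bits. -/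
theorem card_nearly_right_bool_le (D : Unit → Prop) :
    (Finset.card {v : Bool | (Finset.card {g : Unit | ¬ (D g ↔ v = true)} : ℝ)
      ≤ 1 / 25 * Fintype.card Unit} : ℝ) ≤ 1 := by
  have hiff : ∀ v : Bool, (Finset.card {g : Unit | ¬ (D g ↔ v = true)} : ℝ)
      ≤ 1 / 25 * Fintype.card Unit → (D () ↔ v = true) := by
    intro v hv
    by_contra hne
    have : Finset.card {g : Unit | ¬ (D g ↔ v = true)} = 1 := by
      rw [Finset.card_eq_one]; exact ⟨(), by ext; simp [hne]⟩
    rw [this] at hv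
    norm_num at hv
  have : Finset.card {v : Bool | (Finset.card {g : Unit | ¬ (D g ↔ v = true)} : ℝ)
      ≤ 1 / 25 * Fintype.card Unit} ≤ 1 := by
    rw [Finset.card_le_one]
    intro a ha b hb
    have ha := hiff a (Finset.mem_filter.1 ha).2
    have hb := hiff b (Finset.mem_filter.1 hb).2
    exact Bool.eq_iff_iff.2 (ha.symm.trans hb)
  exact_mod_cast this

/-- For accuracy bounded away from zero, bits at scales `R ^ i` of a single coordinate can be
recovered one after the other, from the largest scale on. -/
theorem le_space_of_large_accuracy {d S : ℕ} {Ω : Type*} [MeasurableSpace Ω]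
    (A : TurnstileAlgorithm d S Ω) (μ : MeasureTheory.Measure Ω)
    [MeasureTheory.IsProbabilityMeasure μ] {ε : ℝ} (hε : 1 / 100 ≤ ε) (hε1 : ε < 1) (hd : 2 ≤ d)
    (hA : A.EstimatesLinfty μ d ε (1 / 400)) :
    1 / 10 ^ 8 * ((1 / ε ^ 2) * Real.log (1 / ε) * Real.log d) ≤ S := by
  have hp : 0 < 1 - ε := by linarith
  -- the scales below `j` add up to less than `R ^ j / (R - 1)`, and an estimate can be off by a
  -- factor between `1 - ε` and `1 + ε`, so `R` has to grow like `1 / (1 - ε)`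
  obtain ⟨R, hR4, hR5⟩ : ∃ R : ℕ, 4 / (1 - ε) ≤ R ∧ (R : ℝ) ≤ 4 / (1 - ε) + 1 :=
    ⟨_, Nat.le_ceil _, (Nat.ceil_lt_add_one (by positivity)).le⟩
  rw [div_le_iff₀ hp] at hR4
  have hR4' : (4 : ℝ) ≤ R := by
    have : (0 : ℝ) ≤ R := Nat.cast_nonneg R
    nlinarith
  have hRn : 4 ≤ R := by exact_mod_cast hR4'
  -- at least one scale is needed even if `R > d`
  set L := max 1 (Nat.log R d) with hL
  have hL1 : 1 ≤ L := le_max_left _ _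
  have hW : 2 * ∑ i : Fin L, R ^ (i : ℕ) ≤ d := by
    rcases le_total (Nat.log R d) 1 with h | h
    · have : L = 1 := max_eq_left h
      rw [this]; simpa using hd
    · have : L = Nat.log R d := max_eq_right h
      rw [this]
      exact (two_mul_sum_pow_le (by lia) _).trans (Nat.pow_log_le_self R (by lia))
  let c : Fin d := ⟨0, by lia⟩
  set bit : Bool → ℤ := fun v => if v then 1 else 0 with hbit
  have key := A.log_le_of_augmented μ hA (F := Bool) (G := Unit) (B := 1) (lam := 1 / 8)
    (η := 1 / 25) (by norm_num) (by norm_num) (by norm_num) (fun v _ => v = true)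
    (fun D => by convert card_nearly_right_bool_le D) (L := L)
    (fun i v => [(c, bit v * (R : ℤ) ^ (i : ℕ))]) (fun _ _ => [])
    1 (fun _ _ => rfl) (fun i => (R : ℤ) ^ (i : ℕ))
    (by
      intro i v
      have h1 : (1 : ℤ) ≤ (R : ℤ) ^ (i : ℕ) := one_le_pow₀ (by exact_mod_cast (by lia : 1 ≤ R))
      have h2 : |bit v * (R : ℤ) ^ (i : ℕ)| ≤ (R : ℤ) ^ (i : ℕ) := by
        cases v
        · simp [hbit]
        · simp [hbit]
      simpa only [streamWeight, List.map_cons, List.map_nil, List.sum_cons, List.sum_nil, add_zero]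
        using max_le h1 h2)
    (by intro j g; simp [streamWeight])
    (by exact_mod_cast hW)
    (fun j => 2 * (R : ℝ) ^ (j : ℕ) / (R - 1))
    (by
      intro f j g E
      set X : ℤ := ∑ i ∈ Finset.Iio j, bit (f i) * (R : ℤ) ^ (i : ℕ) + bit (f j) * (R : ℤ) ^ (j : ℕ)
        with hX
      have hvec : streamVector (augmentedStream
          (fun (i : Fin L) v => [(c, bit v * (R : ℤ) ^ (i : ℕ))]) (fun _ (_ : Unit) => []) f j g)
          = X • Pi.single c 1 := by
        have h0 : streamVector ([] : List (TurnstileUpdate d)) = 0 := by ext; simp [streamVector]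
        rw [streamVector_augmentedStream, h0, add_zero, hX, add_smul, Finset.sum_smul]
        simp only [streamVector_singleton]
      rw [hvec, linftyNorm_smul, l2Norm_smul, linftyNorm_single, l2Norm_single, mul_one]
      have hb0 : ∀ v, (0 : ℝ) ≤ (bit v : ℝ) ∧ (bit v : ℝ) ≤ 1 := by
        intro v; cases v <;> simp [hbit]
      have hlow0 : (0 : ℝ) ≤ ∑ i ∈ Finset.Iio j, (bit (f i) : ℝ) * (R : ℝ) ^ (i : ℕ) :=
        Finset.sum_nonneg fun i _ => mul_nonneg (hb0 _).1 (by positivity)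
      have hlow1 : ∑ i ∈ Finset.Iio j, (bit (f i) : ℝ) * (R : ℝ) ^ (i : ℕ)
          ≤ (R : ℝ) ^ (j : ℕ) / (R - 1) := by
        refine (Finset.sum_le_sum fun i _ => ?_).trans (sum_Iio_pow_le (by linarith) j)
        exact mul_le_of_le_one_left (by positivity) (hb0 _).2
      have hXr : (X : ℝ) = ∑ i ∈ Finset.Iio j, (bit (f i) : ℝ) * (R : ℝ) ^ (i : ℕ)
          + bit (f j) * (R : ℝ) ^ (j : ℕ) := by rw [hX]; push_cast; rfl
      have hX0 : (0 : ℝ) ≤ X := by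
        rw [hXr]; exact add_nonneg hlow0 (mul_nonneg (hb0 _).1 (by positivity))
      rw [abs_of_nonneg hX0, abs_le]
      rintro ⟨hE1, hE2⟩
      have hRj : (0 : ℝ) < (R : ℝ) ^ (j : ℕ) := by positivity
      have hR1 : (0 : ℝ) < R - 1 := by linarith
      cases hfj : f j with
      | true =>
        simp only [iff_true]
        rw [hfj, show (bit true : ℝ) = 1 by simp [hbit], one_mul] at hXr
        have hXge : (R : ℝ) ^ (j : ℕ) ≤ X := by linarith
        have h1 : 2 < (1 - ε) * (R - 1) := by nlinarith
        rw [div_lt_iff₀ hR1]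
        have h2 : (1 - ε) * (R : ℝ) ^ (j : ℕ) ≤ E := by nlinarith
        nlinarith
      | false =>
        simp only [Bool.false_eq_true, iff_false, not_lt]
        rw [hfj, show (bit false : ℝ) = 0 by simp [hbit], zero_mul] at hXr
        have hXle : (X : ℝ) ≤ (R : ℝ) ^ (j : ℕ) / (R - 1) := by linarith
        rw [mul_div_assoc]
        nlinarith)
  have hlog2 : 0 < Real.log 2 := Real.log_pos one_lt_two
  have hlog8 : Real.log (1 / 8) = -(3 * Real.log 2) := by
    rw [one_div, Real.log_inv, show (8 : ℝ) = 2 ^ 3 by norm_num, Real.log_pow]; norm_num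
  have hlog54 : 2 * Real.log (1 + 1 / 8 * 2) ≤ Real.log 2 := by
    have := Real.log_le_log (by norm_num) (show (1 + 1 / 8 * 2 : ℝ) ^ 2 ≤ 2 by norm_num)
    rw [Real.log_pow] at this
    exact_mod_cast this
  rw [Fintype.card_bool, Nat.cast_ofNat, hlog8] at key
  have hLr : (1 : ℝ) ≤ L := by exact_mod_cast hL1
  have hS : 1 / 4 * (L : ℝ) ≤ S := by
    refine le_of_mul_le_mul_right (le_trans ?_ key) hlog2
    rw [mul_comm (1 / 4 : ℝ), mul_assoc]
    refine mul_le_mul_of_nonneg_left ?_ (by linarith)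
    norm_num at hlog54 ⊢
    linarith
  have hlogd := log_le_two_mul_log_of_nat_log_le (R := R) (d := d) (L := L) (by lia) (by lia) hL1
    (le_max_right _ _)
  have hlogd0 : 0 ≤ Real.log d := Real.log_natCast_nonneg d
  have hRp : (1 - ε) * Real.log R ≤ 5 := by
    have h1 : Real.log R ≤ R := (Real.log_le_sub_one_of_pos (by linarith)).trans (by linarith)
    have h2 : (1 - ε) * (R : ℝ) ≤ 4 + (1 - ε) := by
      have := mul_le_mul_of_nonneg_left hR5 hp.le
      rwa [mul_add, mul_div_cancel₀ _ hp.ne', mul_one] at this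
    nlinarith
  have hε0 : 0 < ε := by linarith
  have he1 : 1 / ε ≤ 100 := by rw [div_le_iff₀ hε0]; linarith
  have he2 : 1 / ε ^ 2 ≤ 10 ^ 4 := by
    have : 1 / ε ^ 2 = (1 / ε) ^ 2 := by rw [one_div_pow]
    rw [this]
    calc (1 / ε) ^ 2 ≤ 100 ^ 2 := pow_le_pow_left₀ (by positivity) he1 2
      _ = 10 ^ 4 := by norm_num
  have hle : Real.log (1 / ε) ≤ 100 * (1 - ε) := by
    have h1 := Real.log_le_sub_one_of_pos (show 0 < 1 / ε by positivity)
    have h2 : 1 / ε - 1 = (1 / ε) * (1 - ε) := by field_simp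
    rw [h2] at h1
    exact h1.trans (mul_le_mul_of_nonneg_right he1 hp.le)
  have hle0 : 0 ≤ Real.log (1 / ε) := Real.log_nonneg (by rw [le_div_iff₀ hε0]; linarith)
  calc 1 / 10 ^ 8 * ((1 / ε ^ 2) * Real.log (1 / ε) * Real.log d)
      ≤ 1 / 10 ^ 8 * (10 ^ 4 * (100 * (1 - ε)) * (2 * L * Real.log R)) := by gcongr
    _ = 1 / 50 * L * ((1 - ε) * Real.log R) := by ring
    _ ≤ 1 / 50 * L * 5 := by gcongr
    _ ≤ S := by linarith

/-! ### Small accuracy: disjointness of graphs, many scales -/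

/-- The indicator vector of the graph of `v`, with places and values encoded as coordinates. -/
def graphVector {d k q : ℕ} (pos : Fin k × Fin q ↪ Fin d) (v : Fin k → Fin q) : Fin d → ℤ :=
  ∑ r, Pi.single (pos (r, v r)) 1

/-- The stream that adds `w` to all coordinates on the graph of `v`. -/
def graphStream {d k q : ℕ} (pos : Fin k × Fin q ↪ Fin d) (w : ℤ) (v : Fin k → Fin q) :
    List (TurnstileUpdate d) :=
  (List.finRange k).flatMap fun r => [(pos (r, v r), w)]

section graph

variable {d k q : ℕ} (pos : Fin k × Fin q ↪ Fin d)

theorem streamVector_graphStream (w : ℤ) (v : Fin k → Fin q) :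
    streamVector (graphStream pos w v) = w • graphVector pos v := by
  rw [graphStream, streamVector_flatMap_finRange, graphVector, Finset.smul_sum]
  simp only [streamVector_singleton]

theorem graphVector_apply (v : Fin k → Fin q) (r : Fin k) (s : Fin q) :
    graphVector pos v (pos (r, s)) = if s = v r then 1 else 0 := by
  rw [graphVector, Finset.sum_apply, Finset.sum_eq_single r]
  · simp [Pi.single_apply]
  · intro r' _ h
    simp [h.symm]
  · simp

theorem graphVector_apply_of_notMem (v : Fin k → Fin q) {c : Fin d} (hc : c ∉ Set.range pos) :
    graphVector pos v c = 0 := by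
  rw [graphVector, Finset.sum_apply]
  refine Finset.sum_eq_zero fun r _ => ?_
  rw [Pi.single_apply, if_neg]
  rintro rfl
  exact hc ⟨_, rfl⟩

theorem graphVector_eq_zero_or_one (v : Fin k → Fin q) (c : Fin d) :
    graphVector pos v c = 0 ∨ graphVector pos v c = 1 := by
  by_cases hc : c ∈ Set.range pos
  · obtain ⟨⟨r, s⟩, rfl⟩ := hc
    rw [graphVector_apply]
    split_ifs <;> simp
  · exact Or.inl (graphVector_apply_of_notMem pos v hc)

theorem linftyNorm_graphVector_le (v : Fin k → Fin q) : linftyNorm (graphVector pos v) ≤ 1 :=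
  linftyNorm_le zero_le_one fun c => by
    rcases graphVector_eq_zero_or_one pos v c with h | h <;> simp [h]

theorem l2Norm_graphVector (v : Fin k → Fin q) : l2Norm (graphVector pos v) = √k := by
  rw [l2Norm, EuclideanSpace.norm_eq]
  congr 1
  have h1 : ∀ c, ‖(graphVector pos v c : ℝ)‖ ^ 2 = (graphVector pos v c : ℝ) := by
    intro c
    rcases graphVector_eq_zero_or_one pos v c with h | h <;> simp [h]
  simp only [h1]
  have h2 : ∑ c, graphVector pos v c = k := by
    simp only [graphVector, Finset.sum_apply]
    rw [Finset.sum_comm]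
    simp
  exact_mod_cast congrArg (Int.cast : ℤ → ℝ) h2

end graph

/-- With accuracy `ε` and sparsity `k ≤ 1 / (50 ε²)`, an estimate of the maximum norm of the vector
of the game tells whether the graphs of `f j` and `g` meet: the maximum norm is at least `2 * 4 ^ j`
if they do and at most `4 / 3 * 4 ^ j` otherwise, and the permitted error is below `4 ^ j / 3`. -/
theorem threshold_graph {d k q L : ℕ} (pos : Fin k × Fin q ↪ Fin d) {ε : ℝ} (hε : 0 < ε)
    (hk : k * ε ^ 2 ≤ 1 / 50) (f : Fin L → Fin k → Fin q) (j : Fin L) (g : Fin k → Fin q) (E : ℝ)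
    (hE : |E - linftyNorm (streamVector (augmentedStream
        (fun i : Fin L => graphStream pos (4 ^ (i : ℕ))) (fun i => graphStream pos (4 ^ (i : ℕ)))
        f j g))|
      ≤ ε * l2Norm (streamVector (augmentedStream
        (fun i : Fin L => graphStream pos (4 ^ (i : ℕ))) (fun i => graphStream pos (4 ^ (i : ℕ)))
        f j g))) :
    5 / 3 * (4 : ℝ) ^ (j : ℕ) < E ↔ ∃ r, g r = f j r := by
  rw [streamVector_augmentedStream] at hE
  simp only [streamVector_graphStream] at hE
  set u : Fin d → ℤ := ∑ i ∈ Finset.Iio j, (4 : ℤ) ^ (i : ℕ) • graphVector pos (f i) with hu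
  set y : Fin d → ℤ := (4 : ℤ) ^ (j : ℕ) • graphVector pos (f j)
    + (4 : ℤ) ^ (j : ℕ) • graphVector pos g with hy
  have h4 : (0 : ℝ) < 4 ^ (j : ℕ) := by positivity
  have hgeo := sum_Iio_pow_le (show (1 : ℝ) < 4 by norm_num) j
  have hsm : ∀ (i : ℕ) v, l2Norm ((4 : ℤ) ^ i • graphVector pos v) = 4 ^ i * √k := by
    intro i v
    rw [l2Norm_smul, l2Norm_graphVector]; simp
  have hu2 : l2Norm u ≤ 4 ^ (j : ℕ) / 3 * √k := by
    refine (l2Norm_sum_le _ _).trans ?_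
    simp only [hsm]
    rw [← Finset.sum_mul]
    gcongr
    linarith
  have huinf : linftyNorm u ≤ 4 ^ (j : ℕ) / 3 := by
    refine (linftyNorm_sum_le _ _).trans ((Finset.sum_le_sum fun i _ => ?_).trans
      (hgeo.trans (by linarith)))
    rw [linftyNorm_smul]
    simpa using mul_le_mul_of_nonneg_left (linftyNorm_graphVector_le pos (f i))
      (show (0 : ℝ) ≤ 4 ^ (i : ℕ) by positivity)
  have hy2 : l2Norm y ≤ 2 * 4 ^ (j : ℕ) * √k := by
    refine (l2Norm_add_le _ _).trans (le_of_eq ?_)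
    rw [hsm, hsm]; ring
  have hx2 : l2Norm (u + y) ≤ 7 / 3 * 4 ^ (j : ℕ) * √k := by
    linarith [l2Norm_add_le u y]
  have hεk : ε * √k ≤ 142 / 1000 := by
    refine abs_le_of_sq_le_sq' ?_ (by norm_num) |>.2
    rw [mul_pow, Real.sq_sqrt (Nat.cast_nonneg k)]
    linarith
  have herr : ε * l2Norm (u + y) < 4 ^ (j : ℕ) / 3 := by
    calc ε * l2Norm (u + y) ≤ ε * (7 / 3 * 4 ^ (j : ℕ) * √k) := by gcongr
      _ = 7 / 3 * 4 ^ (j : ℕ) * (ε * √k) := by ring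
      _ ≤ 7 / 3 * 4 ^ (j : ℕ) * (142 / 1000) := by gcongr
      _ < 4 ^ (j : ℕ) / 3 := by linarith
  rw [abs_le] at hE
  constructor
  · intro hlt
    by_contra hne
    push Not at hne
    have hyinf : linftyNorm y ≤ 4 ^ (j : ℕ) := by
      refine linftyNorm_le h4.le fun c => ?_
      have hyc : y c = 4 ^ (j : ℕ) * (graphVector pos (f j) c + graphVector pos g c) := by
        rw [hy]; simp [mul_add]
      have hsum : graphVector pos (f j) c + graphVector pos g c = 0
          ∨ graphVector pos (f j) c + graphVector pos g c = 1 := by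
        by_cases hc : c ∈ Set.range pos
        · obtain ⟨⟨r, s⟩, rfl⟩ := hc
          rw [graphVector_apply, graphVector_apply]
          by_cases h1 : s = f j r
          · have h2 : s ≠ g r := fun h => hne r (h.symm.trans h1)
            simp [h1, (hne r).symm]
          · by_cases h2 : s = g r <;> simp [h1, h2, hne r]
        · simp [graphVector_apply_of_notMem pos _ hc]
      rw [hyc]
      rcases hsum with h | h <;> simp [h]
    linarith [linftyNorm_add_le u y]
  · rintro ⟨r, hr⟩
    have hge : 2 * 4 ^ (j : ℕ) ≤ linftyNorm (u + y) := by
      refine le_trans ?_ (abs_le_linftyNorm (u + y) (pos (r, g r)))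
      refine le_trans ?_ (le_abs_self _)
      have h1 : y (pos (r, g r)) = 2 * 4 ^ (j : ℕ) := by
        rw [hy]; simp [graphVector_apply, hr]; ring
      have h2 : 0 ≤ u (pos (r, g r)) := by
        rw [hu, Finset.sum_apply]
        refine Finset.sum_nonneg fun i _ => ?_
        rw [Pi.smul_apply, graphVector_apply]
        split_ifs <;> simp
      have h3 : 2 * 4 ^ (j : ℕ) ≤ (u + y) (pos (r, g r)) := by
        rw [Pi.add_apply, h1]; linarith
      exact_mod_cast h3
    linarith

/-- The space needed to play the disjointness game of graphs of functions `Fin k → Fin (2 * k)` at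
`Nat.log 16 d` scales. -/
theorem mul_log_le_space {d S : ℕ} {Ω : Type*} [MeasurableSpace Ω]
    (A : TurnstileAlgorithm d S Ω) (μ : MeasureTheory.Measure Ω)
    [MeasureTheory.IsProbabilityMeasure μ] {ε : ℝ} (hε : 0 < ε) {k : ℕ}
    (hk : k * ε ^ 2 ≤ 1 / 50) (hk128 : 128 ≤ k) (hkd : 2 * k ^ 2 ≤ d)
    (hA : A.EstimatesLinfty μ d ε (1 / 400)) :
    1 / 4 * (Nat.log 16 d * (k * Real.log k)) ≤ S := by
  set L := Nat.log 16 d with hL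
  obtain ⟨pos⟩ : Nonempty (Fin k × Fin (2 * k) ↪ Fin d) :=
    Function.Embedding.nonempty_of_card_le (by
      simp only [Fintype.card_prod, Fintype.card_fin]; nlinarith)
  have hk0 : 0 < k := by lia
  have : NeZero (2 * k) := ⟨by lia⟩
  have hkr : (128 : ℝ) ≤ k := by exact_mod_cast hk128
  set B : ℝ := 2 ^ k * ((2 * k : ℕ) : ℝ) ^ ((k : ℝ) / 2) with hBdef
  have hB0 : 0 < B := by
    have : (0 : ℝ) < ((2 * k : ℕ) : ℝ) := by positivity
    positivity
  set N : ℝ := (Fintype.card (Fin k → Fin (2 * k)) : ℝ) with hN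
  have hN0 : 0 < N := by rw [hN]; exact_mod_cast Fintype.card_pos
  have hlogB : Real.log B = k * Real.log 2 + k / 2 * (Real.log 2 + Real.log k) := by
    rw [hBdef, Real.log_mul (by positivity) (by positivity), Real.log_pow,
      Real.log_rpow (by positivity)]
    push_cast
    rw [Real.log_mul (by norm_num) (by positivity)]
  have hlogN : Real.log N = k * (Real.log 2 + Real.log k) := by
    rw [hN]
    simp only [Fintype.card_pi, Finset.prod_const, Finset.card_univ, Fintype.card_fin]
    push_cast
    rw [Real.log_pow, Real.log_mul (by norm_num) (by positivity)]
  have hlog2 : 0 < Real.log 2 := Real.log_pos one_lt_two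
  have hlogk : 7 * Real.log 2 ≤ Real.log k := by
    have := Real.log_le_log (by norm_num) (show (2 : ℝ) ^ 7 ≤ k from le_trans (by norm_num) hkr)
    rw [Real.log_pow] at this
    exact_mod_cast this
  have hBN : B ≤ N := by
    rw [← Real.log_le_log_iff hB0 hN0, hlogB, hlogN]
    nlinarith
  have hW : 2 * ∑ i : Fin L, (k * 4 ^ (i : ℕ)) ≤ d := by
    rw [← Finset.mul_sum]
    have h1 := two_mul_sum_pow_le (show 3 ≤ 4 by norm_num) L
    have h2 : (4 ^ L) ^ 2 ≤ d := by
      rw [← pow_mul, mul_comm, pow_mul]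
      exact Nat.pow_log_le_self 16 (by nlinarith)
    have h3 : k * 4 ^ L ≤ d := by nlinarith [sq_nonneg ((k : ℤ) - 4 ^ L)]
    nlinarith
  have hweight : ∀ (i : Fin L) (v : Fin k → Fin (2 * k)),
      streamWeight (graphStream pos (4 ^ (i : ℕ)) v) ≤ (k : ℤ) * 4 ^ (i : ℕ) := by
    intro i v
    rw [graphStream, streamWeight_flatMap_finRange]
    have : (1 : ℤ) ≤ 4 ^ (i : ℕ) := one_le_pow₀ (by norm_num)
    simp [streamWeight, this]
  -- the weight of a bad position that balances the two summands `B` and `lam * N`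
  have key := A.log_le_of_augmented μ hA (F := Fin k → Fin (2 * k)) (G := Fin k → Fin (2 * k))
    (B := B) (lam := B / N) (η := 1 / 25) (by positivity) ((div_le_one hN0).2 hBN) (by norm_num)
    (fun f g => ∃ r, g r = f r) 
    (fun D => by convert card_nearly_right_le (show 2 ≤ k by lia) D)
    (L := L) (fun i => graphStream pos (4 ^ (i : ℕ))) (fun i => graphStream pos (4 ^ (i : ℕ)))
    k (fun i v => by simp [graphStream]) (fun i => (k : ℤ) * 4 ^ (i : ℕ)) hweight hweight
    (by exact_mod_cast hW) (fun j => 5 / 3 * (4 : ℝ) ^ (j : ℕ))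
    (fun f j g E hE => threshold_graph pos hε hk f j g E hE)
  rw [← hN, div_mul_cancel₀ _ hN0.ne', ← two_mul, Real.log_mul two_ne_zero hB0.ne',
    Real.log_div hB0.ne' hN0.ne', hlogB, hlogN] at key
  have hS : (S : ℝ) * Real.log 2 ≤ S := by
    refine mul_le_of_le_one_right (Nat.cast_nonneg S) ?_
    linarith [Real.log_two_lt_d9]
  refine le_trans ?_ (key.trans hS)
  rw [mul_left_comm]
  refine mul_le_mul_of_nonneg_left ?_ (Nat.cast_nonneg L)
  nlinarith

/-- The disjointness game with `k = ⌊1 / (50 ε²)⌋`; the lower bound on `ε` gives `2 * k ^ 2 ≤ d`. -/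
theorem le_space_of_small_accuracy {d S : ℕ} {Ω : Type*} [MeasurableSpace Ω]
    (A : TurnstileAlgorithm d S Ω) (μ : MeasureTheory.Measure Ω)
    [MeasureTheory.IsProbabilityMeasure μ] {ε : ℝ} (hε : 0 < ε) (hε1 : ε < 1 / 100) (hd : 2 ≤ d)
    (hεd : 6 * (Real.log d / d) ^ ((1 : ℝ) / 4) ≤ ε)
    (hA : A.EstimatesLinfty μ d ε (1 / 400)) :
    1 / 10 ^ 8 * ((1 / ε ^ 2) * Real.log (1 / ε) * Real.log d) ≤ S := by
  have hd0 : (0 : ℝ) < d := by positivity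
  have hlogd : Real.log 2 ≤ Real.log d :=
    Real.log_le_log two_pos (by exact_mod_cast hd)
  have hlog2 := Real.log_two_gt_d9
  have hε4 : 1296 * Real.log d ≤ ε ^ 4 * d := by
    have h0 : 0 ≤ Real.log d / d := div_nonneg (by linarith) hd0.le
    have h1 := pow_le_pow_left₀ (by positivity) hεd 4
    rw [mul_pow, ← Real.rpow_natCast (_ ^ _), ← Real.rpow_mul h0] at h1
    norm_num at h1
    rwa [← mul_div_assoc, div_le_iff₀ hd0] at h1
  obtain ⟨k, hk1, hk2⟩ : ∃ k : ℕ, (k : ℝ) ≤ 1 / (50 * ε ^ 2) ∧ 1 / (50 * ε ^ 2) < k + 1 :=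
    ⟨_, Nat.floor_le (by positivity), Nat.lt_floor_add_one _⟩
  rw [le_div_iff₀ (by positivity)] at hk1
  have hε2 : ε ^ 2 ≤ 1 / 10 ^ 4 := by nlinarith
  have hkε : 1 / (100 * ε ^ 2) ≤ k := by
    have h1 : 1 ≤ 1 / (100 * ε ^ 2) := by rw [le_div_iff₀ (by positivity)]; linarith
    have h2 : 1 / (50 * ε ^ 2) = 2 * (1 / (100 * ε ^ 2)) := by field_simp; norm_num
    linarith
  have hk128 : 128 ≤ k := by
    have h1 : 128 < 1 / (50 * ε ^ 2) - 1 := by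
      have : 200 ≤ 1 / (50 * ε ^ 2) := by rw [le_div_iff₀ (by positivity)]; linarith
      linarith
    have : (128 : ℝ) < k := by linarith
    exact_mod_cast this.le
  have hkd : 2 * k ^ 2 ≤ d := by
    have h1 : (2 * k ^ 2 : ℝ) * ε ^ 4 ≤ d * ε ^ 4 := by
      have : (k * ε ^ 2) ^ 2 ≤ (1 / 50 : ℝ) ^ 2 :=
        pow_le_pow_left₀ (by positivity) (by linarith) 2
      nlinarith
    exact_mod_cast le_of_mul_le_mul_right h1 (by positivity)
  have hmain := mul_log_le_space A μ hε (k := k) (by linarith) hk128 hkd hA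
  refine le_trans ?_ hmain
  have hL1 : 1 ≤ Nat.log 16 d := Nat.log_pos (by norm_num) (by nlinarith)
  have hL := log_le_two_mul_log_of_nat_log_le (R := 16) (by norm_num) (by lia) hL1 le_rfl
  have hlog16 : Real.log ((16 : ℕ) : ℝ) ≤ 3 := by
    rw [show ((16 : ℕ) : ℝ) = 2 ^ 4 by norm_num, Real.log_pow]
    push_cast
    linarith [Real.log_two_lt_d9]
  have hL6 : Real.log d ≤ 6 * (Nat.log 16 d : ℝ) := by
    have : (0 : ℝ) ≤ Nat.log 16 d := Nat.cast_nonneg _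
    nlinarith
  have hlogk : Real.log (1 / ε) ≤ Real.log k := by
    refine Real.log_le_log (by positivity) (le_trans ?_ hkε)
    rw [div_le_div_iff₀ hε (by positivity)]
    nlinarith
  have hlogε : 0 ≤ Real.log (1 / ε) := Real.log_nonneg (by rw [le_div_iff₀ hε]; linarith)
  have hkε' : 1 / ε ^ 2 ≤ 100 * k := by
    have : 1 / ε ^ 2 = 100 * (1 / (100 * ε ^ 2)) := by field_simp
    linarith
  have hlogk0 : 0 ≤ Real.log k := hlogε.trans hlogk
  calc 1 / 10 ^ 8 * ((1 / ε ^ 2) * Real.log (1 / ε) * Real.log d)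
      ≤ 1 / 10 ^ 8 * ((100 * k) * Real.log k * (6 * (Nat.log 16 d : ℝ))) := by gcongr
    _ = 6 / 10 ^ 6 * (Nat.log 16 d * (k * Real.log k)) := by ring
    _ ≤ 1 / 4 * (Nat.log 16 d * (k * Real.log k)) :=
        mul_le_mul_of_nonneg_right (by norm_num) (by positivity)

/-! ### All accuracies -/

theorem AdmissibleStream.mono {d M N : ℕ} (h : M ≤ N) {σ : List (TurnstileUpdate d)}
    (hσ : AdmissibleStream M σ) : AdmissibleStream N σ := by
  have hZ : (M : ℤ) ≤ N := by exact_mod_cast h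
  exact ⟨hσ.1.trans h, fun u hu => (hσ.2.1 u hu).trans hZ,
    fun τ hτ i => (hσ.2.2 τ hτ i).trans hZ⟩

theorem mainTheorem6 :
    ∃ δ : ℝ, 0 < δ ∧ δ < 1 ∧ ∃ c : ℝ, 0 < c ∧
      ∀ (C : ℕ), 1 ≤ C → ∀ (d : ℕ) (ε : ℝ), 0 < ε →
        6 * (Real.log d / d) ^ ((1 : ℝ) / 4) ≤ ε →
        ∀ (S : ℕ) (Ω : Type*) [MeasurableSpace Ω] (μ : MeasureTheory.Measure Ω)
          [MeasureTheory.IsProbabilityMeasure μ] (A : TurnstileAlgorithm d S Ω),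
          A.EstimatesLinfty μ (d ^ C) ε δ →
            c * ((1 / ε ^ 2) * Real.log (1 / ε) * Real.log d) ≤ (S : ℝ) := by
  refine ⟨1 / 400, by norm_num, by norm_num, 1 / 10 ^ 8, by norm_num, ?_⟩
  intro C hC d ε hε hεd S Ω _ μ _ A hA
  have hA : A.EstimatesLinfty μ d ε (1 / 400) := fun σ hσ =>
    hA σ (hσ.mono (Nat.le_self_pow (by lia) d))
  rcases le_or_gt 1 ε with h1 | h1
  · refine le_trans ?_ (Nat.cast_nonneg S)
    have h2 : Real.log (1 / ε) ≤ 0 :=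
      Real.log_nonpos (by positivity) (by rw [div_le_iff₀ hε]; linarith)
    have h3 : (1 / ε ^ 2) * Real.log (1 / ε) * Real.log d ≤ 0 :=
      mul_nonpos_of_nonpos_of_nonneg (mul_nonpos_of_nonneg_of_nonpos (by positivity) h2)
        (Real.log_natCast_nonneg d)
    linarith
  rcases lt_or_ge d 2 with hd | hd
  · interval_cases d <;> simp
  rcases le_or_gt (1 / 100) ε with h2 | h2
  · exact le_space_of_large_accuracy A μ h2 h1 hd hA
  · exact le_space_of_small_accuracy A μ hε h2 hd hεd hA
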